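/- Let $d\ge 3$ be an odd integer, let $X=\{1,\dots,d\}$, and let $T$ be the $d$-regular rooted tree whose vertices are the finite words over $X$, with the empty word as root and with the words $ux$, $x\in X$, as the children of the word $u$. Let $\mathrm{Aut}(T)$ be the group of all graph automorphisms of $T$ that fix the root. Define $a_1,\dots,a_d\in\mathrm{Aut}(T)$, with indices and letters taken modulo $d$, by $a_i(\emptyset)=\emptyset$ and $$a_i(i\,v)=(i+1)\,a_i(v),\qquad a_i((i+1)\,v)=i\,a_{i+1}(v),\qquad a_i(x\,v)=x\,v\quad (x\in X\setminus\{i,i+1\})$$ for all words $v$; that is, in terms of wreath recursions, $$a_1=(a_1,a_2,e,\dots,e)(1\ 2),\quad \dots,\quad a_{d-1}=(e,\dots,e,a_{d-1},a_d)(d-1\ \, d),\quad a_d=(a_1,e,\dots,e,a_d)(d\ \,1).$$ Let $G_d=\langle a_1,\dots,a_d\rangle\le\mathrm{Aut}(T)$. For a word $u$, let $\mathrm{Rist}_{G_d}(u)$ be the subgroup of those elements of $G_d$ that fix every vertex of $T$ that does not have $u$ as a prefix, and for $k\ge 0$ let $\mathrm{Rist}_{G_d}(\widehat{k})$ be the subgroup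 generated by the groups $\mathrm{Rist}_{G_d}(u)$ with $u$ of length $k$. Then $G_d$ is a branch group. That is, for every $k\ge 0$, $G_d$ acts transitively on the set $X^k$ of words of length $k$, and $\mathrm{Rist}_{G_d}(\widehat{k})$ has finite index in $G_d$. -/

import Mathlib

/-- The `d`-regular rooted tree: its vertices are the finite words over the `d`-letter alphabet
`Fin d`, its root is the empty word, and the neighbours of a word `u` below it are the words
`u ++ [x]`, one for each letter `x`. -/
def regularTree (d : ℕ) : SimpleGraph (List (Fin d)) where
  Adj u v := (∃ x, v = u ++ [x]) ∨ (∃ x, u = v ++ [x])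
  symm := ⟨fun _ _ h => h.symm⟩
  loopless := ⟨fun u h => by
    rcases h with ⟨x, hx⟩ | ⟨x, hx⟩ <;> simpa using congrArg List.length hx⟩

/-- `Aut(T)`: the group of all graph automorphisms of the `d`-regular rooted tree that fix the
root. The product is Mathlib's, `(g * h) u = g (h u)`. -/
def treeAut (d : ℕ) : Subgroup (regularTree d ≃g regularTree d) where
  carrier := {g | g [] = []}
  one_mem' := rfl
  mul_mem' {g h} hg hh := by
    change g (h []) = []
    rw [show h [] = [] from hh]
    exact hg
  inv_mem' {g} hg := by
    change g.symm [] = []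
    rw [RelIso.symm_apply_eq]
    exact hg.symm

/-- Level transitivity: `G` acts transitively on the words of length `k`, for every `k`. -/
def IsLevelTransitive {d : ℕ} (G : Subgroup (treeAut d)) : Prop :=
  ∀ (k : ℕ) (u v : List (Fin d)), u.length = k → v.length = k → ∃ g ∈ G, g.1 u = v

/-- The rigid stabilizer `Rist_G(u)`: the elements of `G` that fix every vertex outside the
subtree of the words `u ++ w` (`u <+: v` says that `u` is a prefix of `v`). -/
def rist {d : ℕ} (G : Subgroup (treeAut d)) (u : List (Fin d)) : Subgroup (treeAut d) where
  carrier := {g | g ∈ G ∧ ∀ v, ¬ u <+: v → g.1 v = v}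
  one_mem' := ⟨G.one_mem, fun _ _ => rfl⟩
  mul_mem' {g h} hg hh := ⟨G.mul_mem hg.1 hh.1, fun v hv => by
    change g.1 (h.1 v) = v
    rw [hh.2 v hv, hg.2 v hv]⟩
  inv_mem' {g} hg := ⟨G.inv_mem hg.1, fun v hv => by
    change g.1.symm v = v
    rw [RelIso.symm_apply_eq]
    exact (hg.2 v hv).symm⟩

/-- The rigid stabilizer of level `k`: the subgroup generated by the rigid stabilizers of all the
words of length `k`. -/
def levelRist {d : ℕ} (G : Subgroup (treeAut d)) (k : ℕ) : Subgroup (treeAut d) :=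
  ⨆ u ∈ {u : List (Fin d) | u.length = k}, rist G u

/-- Branch groups: level-transitive groups of tree automorphisms all of whose level rigid
stabilizers have finite index. -/
structure IsBranchGroup {d : ℕ} (G : Subgroup (treeAut d)) : Prop where
  levelTransitive : IsLevelTransitive G
  finiteIndex : ∀ k : ℕ, ((levelRist G k).subgroupOf G).FiniteIndex

/-- The cyclic successor of a letter. -/
def nextLetter {d : ℕ} (i : Fin d) : Fin d :=
  ⟨(i.1 + 1) % d, Nat.mod_lt _ (Nat.lt_of_le_of_lt (Nat.zero_le _) i.2)⟩

/-- The generators as maps on words, by their wreath recursion: `a i` acts on the first letter as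
the transposition `(i i+1)`, its section at `i` is `a i`, its section at `i+1` is `a (i+1)`, and
its other sections are trivial (letters are counted cyclically). -/
def genFun {d : ℕ} : Fin d → List (Fin d) → List (Fin d)
  | _, [] => []
  | i, x :: v =>
    Equiv.swap i (nextLetter i) x ::
      if x = i then genFun i v else if x = nextLetter i then genFun (nextLetter i) v else v

/-- The inverses of the generators as maps on words. -/
def genInvFun {d : ℕ} : Fin d → List (Fin d) → List (Fin d)
  | _, [] => []
  | i, y :: v =>
    let x := Equiv.swap i (nextLetter i) y
    x :: if x = i then genInvFun i v
      else if x = nextLetter i then genInvFun (nextLetter i) v else v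

theorem genInvFun_genFun {d : ℕ} (v : List (Fin d)) (i : Fin d) :
    genInvFun i (genFun i v) = v := by
  induction v generalizing i with
  | nil => rfl
  | cons x v ih =>
    simp only [genFun, genInvFun, Equiv.swap_apply_self]
    split_ifs <;> simp [ih]

theorem genFun_genInvFun {d : ℕ} (v : List (Fin d)) (i : Fin d) :
    genFun i (genInvFun i v) = v := by
  induction v generalizing i with
  | nil => rfl
  | cons x v ih =>
    simp only [genFun, genInvFun, Equiv.swap_apply_self]
    split_ifs <;> simp [ih]

theorem genFun_append {d : ℕ} (v : List (Fin d)) (i x : Fin d) :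
    ∃ y, genFun i (v ++ [x]) = genFun i v ++ [y] := by
  induction v generalizing i with
  | nil => exact ⟨Equiv.swap i (nextLetter i) x, by simp [genFun]⟩
  | cons z v ih =>
    simp only [genFun, List.cons_append, List.cons.injEq, true_and]
    split_ifs
    · exact ih _
    · exact ih _
    · exact ⟨x, rfl⟩

theorem genInvFun_append {d : ℕ} (v : List (Fin d)) (i x : Fin d) :
    ∃ y, genInvFun i (v ++ [x]) = genInvFun i v ++ [y] := by
  induction v generalizing i with
  | nil => exact ⟨Equiv.swap i (nextLetter i) x, by simp [genInvFun]⟩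
  | cons z v ih =>
    simp only [genInvFun, List.cons_append, List.cons.injEq, true_and]
    split_ifs
    · exact ih _
    · exact ih _
    · exact ⟨x, rfl⟩

theorem regularTree_adj_map {d : ℕ} {f : List (Fin d) → List (Fin d)}
    (hf : ∀ v x, ∃ y, f (v ++ [x]) = f v ++ [y]) {u v : List (Fin d)}
    (h : (regularTree d).Adj u v) : (regularTree d).Adj (f u) (f v) := by
  rcases h with ⟨x, rfl⟩ | ⟨x, rfl⟩
  · exact Or.inl (hf u x)
  · exact Or.inr (hf v x)

/-- The generator `a i`, as an element of `Aut(T)`. -/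
def gen {d : ℕ} (i : Fin d) : treeAut d :=
  ⟨{ toFun := genFun i
     invFun := genInvFun i
     left_inv := fun v => genInvFun_genFun v i
     right_inv := fun v => genFun_genInvFun v i
     map_rel_iff' := by
      intro u v
      refine ⟨fun h => ?_, regularTree_adj_map fun v x => genFun_append v i x⟩
      have h' := regularTree_adj_map (fun v x => genInvFun_append v i x) h
      simpa [genInvFun_genFun] using h' }, by
    change genFun i [] = []
    rfl⟩

/-- The group `G_d`, generated by `a 0, …, a (d-1)` in `Aut(T)`. -/
def groupG (d : ℕ) : Subgroup (treeAut d) :=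
  Subgroup.closure (Set.range (gen (d := d)))

/-! ### Tree automorphisms supported on the subtree below a letter -/

/-! Write G for `groupG d` and K for the group of those h in G whose copy below a letter x again
lies in G. Everything rests on K having finite index in G.

G is self-replicating: any h in G is the section at x of an element of G carrying x to y
(`moves_of_mem`). This gives level transitivity by induction, and conjugating by such elements shows
that K is normal and independent of x.

Two relations bound G/K. The braid relation holds up to a single section (`braid_eq`), which forces
a_n ≡ a_{n+2} mod K; as d is odd, all generators have one image c. A second relation (`square_eq`)
puts (a_{n+1} a_n)^2 in K, so c^4 = 1 and G/K is cyclic of order at most 4.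

Iterating along a word u, the elements whose copy below u lies in G are of finite index relative to
G. Intersect over the finitely many u of length k: the copies of this intersection below level k
generate a subgroup of the level rigid stabilizer, of finite index in G by self-similarity. -/

theorem treeAut_ext {d : ℕ} {g h : treeAut d} (H : ∀ x v, g.1 (x :: v) = h.1 (x :: v)) :
    g = h := by
  apply Subtype.ext
  apply RelIso.ext
  rintro (_ | ⟨x, v⟩)
  · exact g.2.trans h.2.symm
  · exact H x v

@[simp] theorem treeAut_nil {d : ℕ} (g : treeAut d) : g.1 [] = [] := g.2

@[simp] theorem treeAut_mul_apply {d : ℕ} (g h : treeAut d) (v : List (Fin d)) :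
    (g * h).1 v = g.1 (h.1 v) := rfl

theorem treeAut_coe_mul_apply {d : ℕ} (g h : treeAut d) (v : List (Fin d)) :
    (g.1 * h.1) v = g.1 (h.1 v) := rfl

@[simp] theorem treeAut_one_apply {d : ℕ} (v : List (Fin d)) : (1 : treeAut d).1 v = v := rfl

@[simp] theorem treeAut_inv_apply_self {d : ℕ} (g : treeAut d) (v : List (Fin d)) :
    (g⁻¹).1 (g.1 v) = v := by
  rw [← treeAut_mul_apply, inv_mul_cancel, treeAut_one_apply]

@[simp] theorem treeAut_apply_inv_self {d : ℕ} (g : treeAut d) (v : List (Fin d)) :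
    g.1 ((g⁻¹).1 v) = v := by
  rw [← treeAut_mul_apply, mul_inv_cancel, treeAut_one_apply]

@[simp] theorem treeAut_eq_nil {d : ℕ} (g : treeAut d) {v : List (Fin d)} :
    g.1 v = [] ↔ v = [] := by
  refine ⟨fun h => ?_, fun h => by simp [h]⟩
  rw [← treeAut_inv_apply_self g v, h, treeAut_nil]

theorem regularTree_adj_cons_cons {d : ℕ} {x y : Fin d} {u v : List (Fin d)} :
    (regularTree d).Adj (x :: u) (y :: v) ↔ x = y ∧ (regularTree d).Adj u v := by
  simp only [regularTree, List.cons_append, List.cons.injEq]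
  constructor
  · rintro (⟨z, rfl, h⟩ | ⟨z, rfl, h⟩)
    exacts [⟨rfl, Or.inl ⟨z, h⟩⟩, ⟨rfl, Or.inr ⟨z, h⟩⟩]
  · rintro ⟨rfl, ⟨z, h⟩ | ⟨z, h⟩⟩
    exacts [Or.inl ⟨z, rfl, h⟩, Or.inr ⟨z, rfl, h⟩]

theorem regularTree_adj_nil_cons {d : ℕ} {x : Fin d} {v : List (Fin d)} :
    (regularTree d).Adj [] (x :: v) ↔ v = [] := by
  simp [regularTree]

/-- Apply `f` to the words below the letter `x`, and fix all the other words. -/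
def belowFun {d : ℕ} (x : Fin d) (f : List (Fin d) → List (Fin d)) :
    List (Fin d) → List (Fin d)
  | [] => []
  | y :: v => if y = x then y :: f v else y :: v

theorem belowFun_leftInverse {d : ℕ} (x : Fin d) {f g : List (Fin d) → List (Fin d)}
    (h : Function.LeftInverse f g) : Function.LeftInverse (belowFun x f) (belowFun x g) := by
  rintro (_ | ⟨y, v⟩)
  · rfl
  · by_cases hy : y = x <;> simp [belowFun, hy, h v]

theorem belowFun_adj {d : ℕ} (x : Fin d) (g : treeAut d) (u v : List (Fin d)) :
    (regularTree d).Adj (belowFun x g.1 u) (belowFun x g.1 v) ↔ (regularTree d).Adj u v := by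
  -- Edges at the root survive because `g` fixes the empty word.
  have key : ∀ (y : Fin d) (v : List (Fin d)),
      (regularTree d).Adj [] (belowFun x g.1 (y :: v)) ↔ (regularTree d).Adj [] (y :: v) := by
    intro y v
    by_cases hy : y = x <;> simp [belowFun, hy, regularTree_adj_nil_cons]
  rcases u with _ | ⟨y, u⟩ <;> rcases v with _ | ⟨z, v⟩
  · rfl
  · exact key z v
  · rw [SimpleGraph.adj_comm, SimpleGraph.adj_comm _ (y :: u)]
    exact key y u
  · by_cases hyz : y = z
    · subst hyz
      by_cases hy : y = x <;>
        simp only [belowFun, hy, if_true, if_false, regularTree_adj_cons_cons, true_and]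
      exact g.1.map_rel_iff'
    · by_cases hy : y = x <;> by_cases hz : z = x <;>
        simp [belowFun, hy, hz, regularTree_adj_cons_cons] <;> simp_all

/-- The embedding of `Aut(T)` into itself that lets an automorphism act on the subtree below the
letter `x`. -/
def belowHom {d : ℕ} (x : Fin d) : treeAut d →* treeAut d :=
  MonoidHom.mk'
    (fun g => ⟨{ toFun := belowFun x g.1
                 invFun := belowFun x (g⁻¹).1
                 left_inv := belowFun_leftInverse x (treeAut_inv_apply_self g)
                 right_inv := belowFun_leftInverse x (treeAut_apply_inv_self g)
                 map_rel_iff' := belowFun_adj x g _ _ }, rfl⟩)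
    (fun g h => treeAut_ext fun y v => by
      change belowFun x (g * h).1 (y :: v) = belowFun x g.1 (belowFun x h.1 (y :: v))
      by_cases hy : y = x <;> simp [belowFun, hy, treeAut_coe_mul_apply])

@[simp] theorem belowHom_apply_self {d : ℕ} (x : Fin d) (g : treeAut d) (v : List (Fin d)) :
    (belowHom x g).1 (x :: v) = x :: g.1 v := by
  change belowFun x g.1 (x :: v) = _
  simp [belowFun]

theorem belowHom_apply_of_ne {d : ℕ} {x y : Fin d} (h : y ≠ x) (g : treeAut d)
    (v : List (Fin d)) : (belowHom x g).1 (y :: v) = y :: v := by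
  change belowFun x g.1 (y :: v) = _
  simp [belowFun, h]

/-- The embedding of `Aut(T)` into itself that lets an automorphism act on the subtree below the
word `u`. -/
def belowWordHom {d : ℕ} : List (Fin d) → (treeAut d →* treeAut d)
  | [] => MonoidHom.id _
  | x :: u => (belowHom x).comp (belowWordHom u)

theorem belowWordHom_append {d : ℕ} (u v : List (Fin d)) :
    belowWordHom (u ++ v) = (belowWordHom u).comp (belowWordHom v) := by
  induction u with
  | nil => rfl
  | cons x u ih => simp [belowWordHom, ih, MonoidHom.comp_assoc]

theorem belowWordHom_apply_of_not_prefix {d : ℕ} (u : List (Fin d)) (g : treeAut d)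
    {v : List (Fin d)} (h : ¬ u <+: v) : (belowWordHom u g).1 v = v := by
  induction u generalizing v with
  | nil => exact absurd (List.nil_prefix) h
  | cons x u ih =>
    rcases v with _ | ⟨y, v⟩
    · exact treeAut_nil _
    · change (belowHom x (belowWordHom u g)).1 (y :: v) = _
      by_cases hy : y = x
      · subst hy
        rw [belowHom_apply_self, ih]
        simpa using h
      · exact belowHom_apply_of_ne hy _ _

/-! ### The generators -/

/-- The letter with number `n`, counted cyclically. -/
def letter (d : ℕ) [NeZero d] (n : ℕ) : Fin d := Fin.ofNat d n

theorem letter_eq_iff {d : ℕ} [NeZero d] {m n : ℕ} : letter d m = letter d n ↔ m ≡ n [MOD d] := by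
  simp [letter, Fin.ext_iff, Fin.ofNat, Nat.ModEq]

theorem letter_val {d : ℕ} [NeZero d] (x : Fin d) : letter d x = x := by
  simp [letter]

theorem nextLetter_letter {d : ℕ} [NeZero d] (n : ℕ) :
    nextLetter (letter d n) = letter d (n + 1) := by
  simp [letter, nextLetter, Fin.ofNat]

theorem letter_ne_add {d : ℕ} [NeZero d] (n : ℕ) {k : ℕ} (hk : 0 < k) (hkd : k < d) :
    letter d n ≠ letter d (n + k) := by
  rw [Ne, letter_eq_iff]
  intro h
  have h' : 0 ≡ k [MOD d] := Nat.ModEq.add_left_cancel' n h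
  exact absurd (Nat.le_of_dvd hk ((Nat.modEq_zero_iff_dvd).1 h'.symm)) (by omega)

theorem gen_mem {d : ℕ} (i : Fin d) : gen i ∈ groupG d := Subgroup.subset_closure ⟨i, rfl⟩

theorem gen_apply {d : ℕ} (i x : Fin d) (v : List (Fin d)) :
    (gen i).1 (x :: v) = Equiv.swap i (nextLetter i) x :: if x = i then (gen i).1 v
      else if x = nextLetter i then (gen (nextLetter i)).1 v else v := rfl

section
variable {d : ℕ} [NeZero d]

theorem gen_apply_letter (n : ℕ) (v : List (Fin d)) :
    (gen (letter d n)).1 (letter d n :: v) = letter d (n + 1) :: (gen (letter d n)).1 v := by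
  simp [gen_apply, nextLetter_letter]

theorem gen_apply_letter_succ (hd : 1 < d) (n : ℕ) (v : List (Fin d)) :
    (gen (letter d n)).1 (letter d (n + 1) :: v) = letter d n :: (gen (letter d (n + 1))).1 v := by
  simp [gen_apply, nextLetter_letter, (letter_ne_add (d := d) n one_pos hd).symm]

theorem gen_apply_of_ne {n : ℕ} {x : Fin d} (h : x ≠ letter d n) (h' : x ≠ letter d (n + 1))
    (v : List (Fin d)) : (gen (letter d n)).1 (x :: v) = x :: v := by
  simp [gen_apply, nextLetter_letter, h, h', Equiv.swap_apply_of_ne_of_ne]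

end

/-! ### Self-similarity and self-replication -/

/-- Some element of `G` maps the subtree below `x` to the subtree below `y`, with section `h`. -/
def Moves {d : ℕ} (x y : Fin d) (h : treeAut d) : Prop :=
  ∃ k ∈ groupG d, ∀ v, k.1 (x :: v) = y :: h.1 v

theorem Moves.refl {d : ℕ} (x : Fin d) : Moves x x 1 := ⟨1, one_mem _, fun _ => rfl⟩

theorem Moves.trans {d : ℕ} {x y z : Fin d} {g h : treeAut d} (h₁ : Moves x y g)
    (h₂ : Moves y z h) : Moves x z (h * g) := by
  obtain ⟨k, hk, e⟩ := h₁
  obtain ⟨l, hl, e'⟩ := h₂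
  exact ⟨l * k, mul_mem hl hk, fun v => by simp [treeAut_coe_mul_apply, e, e']⟩

theorem Moves.inv {d : ℕ} {x y : Fin d} {h : treeAut d} (H : Moves x y h) : Moves y x h⁻¹ := by
  obtain ⟨k, hk, e⟩ := H
  refine ⟨k⁻¹, inv_mem hk, fun v => ?_⟩
  rw [← treeAut_apply_inv_self h v, ← e, treeAut_inv_apply_self, treeAut_apply_inv_self]

/-- Both a_n^2 (from n to n) and a_{n+1} a_n (from n to n+2) have section a_{n+1} a_n at n, so their
quotient moves n to n+2 with trivial section. As d is odd, steps of 2 reach every letter. -/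
theorem moves_one {d : ℕ} (hd : Odd d) (hd3 : 3 ≤ d) (x y : Fin d) : Moves x y 1 := by
  have : NeZero d := ⟨by omega⟩
  have up : ∀ n, Moves (letter d n) (letter d (n + 1)) (gen (letter d n)) := fun n =>
    ⟨_, gen_mem _, gen_apply_letter n⟩
  have down : ∀ n, Moves (letter d (n + 1)) (letter d n) (gen (letter d (n + 1))) := fun n =>
    ⟨_, gen_mem _, gen_apply_letter_succ (by omega) n⟩
  have two : ∀ n, Moves (letter d n) (letter d (n + 2)) 1 := fun n => by
    simpa using ((up n).trans (down n)).inv.trans ((up n).trans (up (n + 1)))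
  have even : ∀ n j, Moves (letter d n) (letter d (n + 2 * j)) 1 := by
    intro n j
    induction j with
    | zero => exact Moves.refl _
    | succ j ih => simpa [mul_add, ← add_assoc] using ih.trans (two _)
  obtain ⟨e, he⟩ := hd
  -- With d = 2e+1, 2(e+1) ≡ 1 and 2e ≡ -1 mod d, so this is (y - x)/2 without subtraction.
  have h := even x ((y + 2 * e * x) * (e + 1))
  rw [letter_val, show letter d (x + 2 * ((y + 2 * e * x) * (e + 1))) = y from ?_] at h
  · exact h
  · conv_rhs => rw [← letter_val y]
    rw [letter_eq_iff,
      show (x : ℕ) + 2 * ((y + 2 * e * x) * (e + 1)) = y + (2 * e + 1) * (x + y + 2 * e * x) by ring,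
      ← he]
    simp [Nat.ModEq]

/-- `G` is self-replicating. -/
theorem moves_of_mem {d : ℕ} (hd : Odd d) (hd3 : 3 ≤ d) (x y : Fin d) {h : treeAut d}
    (hh : h ∈ groupG d) : Moves x y h := by
  have : NeZero d := ⟨by omega⟩
  have one := moves_one hd hd3
  suffices Moves x x h by simpa using this.trans (one x y)
  induction hh using Subgroup.closure_induction with
  | mem h hh =>
    obtain ⟨i, rfl⟩ := hh
    have up : Moves i (letter d (i + 1)) (gen i) :=
      ⟨_, gen_mem _, by simpa [letter_val] using gen_apply_letter (d := d) i⟩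
    simpa using ((one x i).trans up).trans (one _ x)
  | one => exact Moves.refl x
  | mul g h _ _ hg hh => exact hh.trans hg
  | inv g _ hg => exact hg.inv

/-- `G` is self-similar. -/
theorem exists_sections {d : ℕ} {g : treeAut d} (hg : g ∈ groupG d) :
    ∃ (σ : Equiv.Perm (Fin d)) (s : Fin d → treeAut d), (∀ x, s x ∈ groupG d) ∧
      ∀ x v, g.1 (x :: v) = σ x :: (s x).1 v := by
  induction hg using Subgroup.closure_induction with
  | mem h hh =>
    obtain ⟨i, rfl⟩ := hh
    refine ⟨Equiv.swap i (nextLetter i), fun x => if x = i then gen i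
      else if x = nextLetter i then gen (nextLetter i) else 1, fun x => ?_, fun x v => ?_⟩
    · dsimp only
      split_ifs
      exacts [gen_mem _, gen_mem _, one_mem _]
    · rw [gen_apply]
      dsimp only
      split_ifs <;> rfl
  | one => exact ⟨1, fun _ => 1, fun _ => one_mem _, fun _ _ => rfl⟩
  | mul g h _ _ hg hh =>
    obtain ⟨σ, s, hs, e⟩ := hg
    obtain ⟨τ, t, ht, e'⟩ := hh
    exact ⟨σ * τ, fun x => s (τ x) * t x, fun x => mul_mem (hs _) (ht _),
      fun x v => by simp [treeAut_coe_mul_apply, e, e']⟩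
  | inv g _ hg =>
    obtain ⟨σ, s, hs, e⟩ := hg
    refine ⟨σ⁻¹, fun x => (s (σ⁻¹ x))⁻¹, fun x => inv_mem (hs _), fun x v => ?_⟩
    have := e (σ⁻¹ x) ((s (σ⁻¹ x))⁻¹.1 v)
    rw [treeAut_apply_inv_self, ← Equiv.Perm.mul_apply, mul_inv_cancel, Equiv.Perm.one_apply] at this
    rw [← this, treeAut_inv_apply_self]

theorem levelTransitive_groupG {d : ℕ} (hd : Odd d) (hd3 : 3 ≤ d) :
    IsLevelTransitive (groupG d) := by
  intro k
  induction k with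
  | zero =>
    intro u v hu hv
    rw [List.length_eq_zero_iff] at hu hv
    exact ⟨1, one_mem _, by rw [hu, hv]; rfl⟩
  | succ k ih =>
    rintro (_ | ⟨x, u⟩) (_ | ⟨y, v⟩) hu hv
    · simp at hu
    · simp at hu
    · simp at hv
    · obtain ⟨h, hh, e⟩ := ih u v (by simpa using hu) (by simpa using hv)
      obtain ⟨g, hg, e'⟩ := moves_of_mem hd hd3 x y hh
      exact ⟨g, hg, by rw [e', e]⟩

/-! ### The branching subgroup -/

/-- The elements `h` of `G` such that acting by `h` below the letter `x` defines an element
of `G`. -/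
def branching {d : ℕ} (x : Fin d) : Subgroup (groupG d) :=
  ((groupG d).comap (belowHom x)).subgroupOf (groupG d)

theorem mem_branching {d : ℕ} {x : Fin d} {h : groupG d} :
    h ∈ branching x ↔ belowHom x h.1 ∈ groupG d := Iff.rfl

theorem conj_belowHom {d : ℕ} {x y : Fin d} {k h : treeAut d}
    (H : ∀ v, k.1 (x :: v) = y :: h.1 v) (g : treeAut d) :
    k * belowHom x g * k⁻¹ = belowHom y (h * g * h⁻¹) := by
  rw [mul_inv_eq_iff_eq_mul]
  refine treeAut_ext fun z v => ?_
  by_cases hz : z = x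
  · subst hz
    rw [treeAut_mul_apply, treeAut_mul_apply, belowHom_apply_self, H, H, belowHom_apply_self]
    simp only [treeAut_mul_apply, treeAut_inv_apply_self]
  · rw [treeAut_mul_apply, treeAut_mul_apply, belowHom_apply_of_ne hz]
    rcases e : k.1 (z :: v) with _ | ⟨t, w⟩
    · exact (treeAut_nil _).symm
    · rw [belowHom_apply_of_ne]
      -- A word below `y` is already the image under `k` of a word below `x`, so injectivity would
      -- give `z = x`.
      rintro rfl
      have := H ((h⁻¹).1 w)
      rw [treeAut_apply_inv_self, ← e] at this
      have := k.1.injective this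
      simp_all

section
variable {d : ℕ} (hd : Odd d) (hd3 : 3 ≤ d)
include hd hd3

theorem conj_mem_branching (x y : Fin d) {g : groupG d} (hg : g ∈ branching x) (h : groupG d) :
    h * g * h⁻¹ ∈ branching y := by
  obtain ⟨k, hk, e⟩ := moves_of_mem hd hd3 x y h.2
  have := conj_belowHom e g.1
  exact mem_branching.2 (this ▸ mul_mem (mul_mem hk hg) (inv_mem hk))

theorem branching_normal (x : Fin d) : (branching x).Normal :=
  ⟨fun _ hg h => conj_mem_branching hd hd3 x x hg h⟩

theorem branching_eq (x y : Fin d) : branching x = branching y := by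
  ext g
  exact ⟨fun h => by simpa using conj_mem_branching hd hd3 x y h 1,
    fun h => by simpa using conj_mem_branching hd hd3 y x h 1⟩

end

/-- The generators as elements of `G`. -/
def genG (d : ℕ) [NeZero d] (n : ℕ) : groupG d := ⟨gen (letter d n), gen_mem _⟩

/-! ### Two relations modulo sections -/

section
variable {d : ℕ} [NeZero d]

/-- Both braid words induce the transposition of n and n+2, and their sections differ only at n+1.
-/
theorem braid_eq (hd3 : 3 ≤ d) (n : ℕ) :
    gen (letter d n) * gen (letter d (n + 1)) * gen (letter d n) =
      gen (letter d (n + 1)) * gen (letter d n) * gen (letter d (n + 1)) *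
        belowHom (letter d (n + 1)) ((gen (letter d (n + 1)))⁻¹ * (gen (letter d (n + 2)))⁻¹ *
          (gen (letter d n) * gen (letter d (n + 1)))) := by
  have h01 : letter d n ≠ letter d (n + 1) := letter_ne_add n one_pos (by omega)
  have h02 : letter d n ≠ letter d (n + 2) := letter_ne_add n two_pos (by omega)
  have h12 : letter d (n + 1) ≠ letter d (n + 2) := letter_ne_add (n + 1) one_pos (by omega)
  have hd1 : 1 < d := by omega
  refine treeAut_ext fun x v => ?_
  have e0 := gen_apply_letter (d := d) n
  have e1 := gen_apply_letter_succ hd1 n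
  have e2 := gen_apply_letter (d := d) (n + 1)
  have e3 := gen_apply_letter_succ hd1 (n + 1)
  have e4 := gen_apply_of_ne h02.symm h12.symm
  have e5 := gen_apply_of_ne h01 h02
  simp only [add_assoc, Nat.reduceAdd] at e2 e3
  by_cases hx0 : x = letter d n
  · subst hx0
    simp only [treeAut_mul_apply, belowHom_apply_of_ne h01, e0, e2, e4, e5]
  by_cases hx1 : x = letter d (n + 1)
  · subst hx1
    simp only [treeAut_mul_apply, belowHom_apply_self, e0, e1, e2, e3, e4, e5,
      treeAut_apply_inv_self]
  by_cases hx2 : x = letter d (n + 2)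
  · subst hx2
    simp only [treeAut_mul_apply, belowHom_apply_of_ne h12.symm, e1, e3, e4, e5]
  · simp only [treeAut_mul_apply, belowHom_apply_of_ne hx1, gen_apply_of_ne hx0 hx1,
      gen_apply_of_ne hx1 hx2]

/-- Squares of generators fix the first level, so a_n^2 a_{n+1} a_n^2 and a_{n+1}^3 both induce the
transposition of n+1 and n+2. Of the three correcting sections, the last two are trivial modulo K
once a_n ≡ a_{n+2}. -/
theorem square_eq (hd3 : 3 ≤ d) (n : ℕ) :
    gen (letter d n) * gen (letter d n) * gen (letter d (n + 1)) * gen (letter d n) *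
        gen (letter d n) =
      belowHom (letter d n) ((gen (letter d (n + 1)) * gen (letter d n)) ^ 2) *
      belowHom (letter d (n + 1)) (gen (letter d n) * (gen (letter d (n + 2)))⁻¹) *
      belowHom (letter d (n + 2)) (gen (letter d (n + 1)) *
        (gen (letter d n) * (gen (letter d (n + 2)))⁻¹) * (gen (letter d (n + 1)))⁻¹) *
      (gen (letter d (n + 1)) * gen (letter d (n + 1)) * gen (letter d (n + 1))) := by
  have h01 : letter d n ≠ letter d (n + 1) := letter_ne_add n one_pos (by omega)
  have h02 : letter d n ≠ letter d (n + 2) := letter_ne_add n two_pos (by omega)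
  have h12 : letter d (n + 1) ≠ letter d (n + 2) := letter_ne_add (n + 1) one_pos (by omega)
  have hd1 : 1 < d := by omega
  refine treeAut_ext fun x v => ?_
  have e0 := gen_apply_letter (d := d) n
  have e1 := gen_apply_letter_succ hd1 n
  have e2 := gen_apply_letter (d := d) (n + 1)
  have e3 := gen_apply_letter_succ hd1 (n + 1)
  have e4 := gen_apply_of_ne h02.symm h12.symm
  have e5 := gen_apply_of_ne h01 h02
  simp only [add_assoc, Nat.reduceAdd] at e2 e3
  by_cases hx0 : x = letter d n
  · subst hx0
    simp only [treeAut_mul_apply, belowHom_apply_self, belowHom_apply_of_ne h01,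
      belowHom_apply_of_ne h02, e0, e1, e5, pow_two]
  by_cases hx1 : x = letter d (n + 1)
  · subst hx1
    simp only [treeAut_mul_apply, belowHom_apply_self, belowHom_apply_of_ne h12.symm,
      belowHom_apply_of_ne h02.symm, e0, e1, e2, e3, e4, treeAut_inv_apply_self]
  by_cases hx2 : x = letter d (n + 2)
  · subst hx2
    simp only [treeAut_mul_apply, belowHom_apply_self, belowHom_apply_of_ne h12,
      belowHom_apply_of_ne h01.symm,
      e0, e1, e2, e3, e4, treeAut_inv_apply_self]
  · simp only [treeAut_mul_apply, belowHom_apply_of_ne hx0, belowHom_apply_of_ne hx1,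
      belowHom_apply_of_ne hx2, gen_apply_of_ne hx0 hx1, gen_apply_of_ne hx1 hx2]

end

/-! ### Finiteness of G/K -/

section
variable {d : ℕ} [NeZero d] (hd : Odd d) (hd3 : 3 ≤ d)
include hd hd3

theorem inv_genG_mul_genG_mem (x : Fin d) (n : ℕ) :
    (genG d (n + 2))⁻¹ * genG d n ∈ branching x := by
  rw [branching_eq hd hd3 x (letter d (n + 1))]
  have := branching_normal hd hd3 (letter d (n + 1))
  have key : (genG d (n + 1))⁻¹ * (genG d (n + 2))⁻¹ * (genG d n * genG d (n + 1)) ∈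
      branching (letter d (n + 1)) := by
    refine mem_branching.2 (Set.mem_of_eq_of_mem (inv_mul_eq_iff_eq_mul.2 (braid_eq hd3 n)).symm ?_)
    have m := fun k => gen_mem (letter d k)
    exact mul_mem (inv_mem (mul_mem (mul_mem (m _) (m _)) (m _)))
      (mul_mem (mul_mem (m _) (m _)) (m _))
  simpa [mul_assoc] using this.conj_mem _ key (genG d (n + 1))

theorem mk_genG_eq (x : Fin d) [(branching x).Normal] (m n : ℕ) :
    (genG d m : groupG d ⧸ branching x) = genG d n := by
  have two : ∀ n, (genG d (n + 2) : groupG d ⧸ branching x) = genG d n := fun n =>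
    QuotientGroup.eq.2 (inv_genG_mul_genG_mem hd hd3 x n)
  have even : ∀ n j, (genG d (n + 2 * j) : groupG d ⧸ branching x) = genG d n := by
    intro n j
    induction j with
    | zero => rfl
    | succ j ih => rw [← ih, ← two (n + 2 * j)]; rfl
  obtain ⟨e, he⟩ := hd
  -- As in `moves_one`, this is (m - n)/2 modulo d.
  rw [← even n ((m + 2 * e * n) * (e + 1))]
  suffices letter d m = letter d (n + 2 * ((m + 2 * e * n) * (e + 1))) by simp only [genG, this]
  rw [letter_eq_iff,
    show n + 2 * ((m + 2 * e * n) * (e + 1)) = m + (2 * e + 1) * (n + m + 2 * e * n) by ring, ← he]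
  simp [Nat.ModEq]

theorem mk_genG_pow_four (x : Fin d) [(branching x).Normal] :
    (genG d 0 : groupG d ⧸ branching x) ^ 4 = 1 := by
  have key : (genG d 1 * genG d 0) ^ 2 ∈ branching x := by
    rw [branching_eq hd hd3 x (letter d 0)]
    have h02 : genG d 0 * (genG d 2)⁻¹ ∈ branching x := by
      rw [← QuotientGroup.eq_one_iff, QuotientGroup.mk_mul, QuotientGroup.mk_inv,
        mk_genG_eq hd hd3 x 0 2, mul_inv_cancel]
    have h02' := conj_mem_branching hd hd3 x (letter d 2) h02 (genG d 1)
    rw [branching_eq hd hd3 x (letter d 1)] at h02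
    have e := square_eq hd3 0
    rw [← mul_inv_eq_iff_eq_mul, ← mul_inv_eq_iff_eq_mul, ← mul_inv_eq_iff_eq_mul] at e
    have m := fun k => gen_mem (letter d k)
    rw [mem_branching] at h02 h02'
    suffices belowHom (letter d 0) ((gen (letter d (0 + 1)) * gen (letter d 0)) ^ 2) ∈ groupG d from
      mem_branching.2 this
    rw [← e]
    refine mul_mem (mul_mem (mul_mem ?_ (inv_mem ?_)) (inv_mem h02')) (inv_mem h02)
    · exact mul_mem (mul_mem (mul_mem (mul_mem (m _) (m _)) (m _)) (m _)) (m _)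
    · exact mul_mem (mul_mem (m _) (m _)) (m _)
  rw [← QuotientGroup.eq_one_iff, QuotientGroup.mk_pow, QuotientGroup.mk_mul,
    mk_genG_eq hd hd3 x 1 0] at key
  rw [← key, ← pow_two, ← pow_mul]

end

theorem branching_finiteIndex {d : ℕ} (hd : Odd d) (hd3 : 3 ≤ d) (x : Fin d) :
    (branching x).FiniteIndex := by
  have : NeZero d := ⟨by omega⟩
  have := branching_normal hd hd3 x
  set c : groupG d ⧸ branching x := (genG d 0 : groupG d ⧸ branching x) with hc
  have hfin : (Subgroup.zpowers c : Set (groupG d ⧸ branching x)).Finite :=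
    finite_zpowers.2 (isOfFinOrder_iff_pow_eq_one.2 ⟨4, by norm_num, mk_genG_pow_four hd hd3 x⟩)
  have hall : ∀ g (hg : g ∈ groupG d),
      ((⟨g, hg⟩ : groupG d) : groupG d ⧸ branching x) ∈ Subgroup.zpowers c := by
    intro g hg
    induction hg using Subgroup.closure_induction with
    | mem g hg =>
      obtain ⟨i, rfl⟩ := hg
      have := mk_genG_eq hd hd3 x i 0
      simp only [genG, letter_val] at this
      rw [this]
      exact Subgroup.mem_zpowers c
    | one => exact one_mem _
    | mul g h _ _ hg hh => exact mul_mem hg hh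
    | inv g _ hg => exact inv_mem hg
  have : Finite (groupG d ⧸ branching x) := by
    rw [← Set.finite_univ_iff]
    refine hfin.subset fun q _ => ?_
    obtain ⟨g, rfl⟩ := QuotientGroup.mk_surjective q
    exact hall g.1 g.2
  exact Subgroup.finiteIndex_of_finite_quotient

/-! ### The level rigid stabilizers -/

theorem Subgroup.relIndex_ne_zero_of_finite {Γ α : Type*} [Group Γ] [Finite α] {H K : Subgroup Γ}
    (f : K → α) (hf : ∀ g h : K, f g = f h → g.1⁻¹ * h.1 ∈ H) : H.relIndex K ≠ 0 := by
  have : Finite (K ⧸ H.subgroupOf K) := by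
    refine Finite.of_injective (fun q => f q.out) fun p q h => ?_
    rw [← QuotientGroup.out_eq' p, ← QuotientGroup.out_eq' q, QuotientGroup.eq]
    exact hf _ _ h
  exact Subgroup.finiteIndex_of_finite_quotient.index_ne_zero

/-- The subgroup generated by the copies of `H` below the words of length `k`. -/
def belowLevel {d : ℕ} (k : ℕ) (H : Subgroup (treeAut d)) : Subgroup (treeAut d) :=
  ⨆ u ∈ {u : List (Fin d) | u.length = k}, H.map (belowWordHom u)

theorem map_belowWordHom_le {d : ℕ} (u : List (Fin d)) (H : Subgroup (treeAut d)) :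
    H.map (belowWordHom u) ≤ belowLevel u.length H :=
  le_iSup₂_of_le u rfl le_rfl

/-- An element of G is determined, up to a product of copies of H on the first level, by its
first-level permutation and the classes of its sections modulo H: finitely many data. -/
theorem belowLevel_one_relIndex {d : ℕ} {H : Subgroup (treeAut d)}
    (hH : H.relIndex (groupG d) ≠ 0) : (belowLevel 1 H).relIndex (groupG d) ≠ 0 := by
  have hfin : Finite (groupG d ⧸ H.subgroupOf (groupG d)) :=
    have : (H.subgroupOf (groupG d)).FiniteIndex := ⟨hH⟩
    Subgroup.finite_quotient_of_finiteIndex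
  choose σ s hs e using fun g : groupG d => exists_sections g.2
  refine Subgroup.relIndex_ne_zero_of_finite
    (fun g => (σ g, fun x => ((⟨s g x, hs g x⟩ : groupG d) :
      groupG d ⧸ H.subgroupOf (groupG d)))) fun g h hgh => ?_
  obtain ⟨hσ, hsec⟩ := Prod.ext_iff.1 hgh
  have hmem : ∀ x, (s g x)⁻¹ * s h x ∈ H := fun x =>
    (QuotientGroup.eq (s := H.subgroupOf (groupG d))).1 (congrFun hsec x)
  -- Build the product of the section quotients one letter at a time.
  have part : ∀ A : Finset (Fin d), ∃ k ∈ belowLevel 1 H, ∀ x v,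
      k.1 (x :: v) = x :: if x ∈ A then ((s g x)⁻¹ * s h x).1 v else v := by
    intro A
    induction A using Finset.induction_on with
    | empty => exact ⟨1, one_mem _, fun _ _ => rfl⟩
    | insert a A ha ih =>
      obtain ⟨k, hk, ek⟩ := ih
      refine ⟨belowHom a ((s g a)⁻¹ * s h a) * k, mul_mem ?_ hk, fun x v => ?_⟩
      · exact map_belowWordHom_le [a] H ⟨_, hmem a, rfl⟩
      · rw [treeAut_mul_apply, ek]
        by_cases hx : x = a
        · subst hx
          rw [if_neg ha, belowHom_apply_self, if_pos (Finset.mem_insert_self _ _)]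
        · rw [belowHom_apply_of_ne hx]
          simp only [Finset.mem_insert, hx, false_or]
  obtain ⟨k, hk, ek⟩ := part Finset.univ
  convert hk
  refine treeAut_ext fun x v => ?_
  rw [ek, treeAut_mul_apply, e h, ← show σ g = σ h from hσ]
  have := e g x (((s g x)⁻¹ * s h x).1 v)
  simp only [treeAut_mul_apply, treeAut_apply_inv_self] at this
  rw [← this, treeAut_inv_apply_self]
  simp

theorem belowLevel_comp_le {d : ℕ} (k : ℕ) (H : Subgroup (treeAut d)) :
    belowLevel k (belowLevel 1 H) ≤ belowLevel (k + 1) H := by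
  refine iSup₂_le fun u hu => ?_
  simp only [belowLevel, Subgroup.map_iSup]
  refine iSup₂_le fun v hv => ?_
  rw [Subgroup.map_map, ← belowWordHom_append]
  exact le_iSup₂_of_le (u ++ v) (by simp_all) le_rfl

theorem belowLevel_relIndex {d : ℕ} (k : ℕ) {H : Subgroup (treeAut d)}
    (hH : H.relIndex (groupG d) ≠ 0) : (belowLevel k H).relIndex (groupG d) ≠ 0 := by
  induction k generalizing H with
  | zero =>
    refine mt (Subgroup.relIndex_eq_zero_of_le_left ?_) hH
    simpa [belowWordHom] using map_belowWordHom_le [] H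
  | succ k ih =>
    exact mt (Subgroup.relIndex_eq_zero_of_le_left (belowLevel_comp_le k H))
      (ih (belowLevel_one_relIndex hH))

theorem comap_belowWordHom_relIndex {d : ℕ} (hd : Odd d) (hd3 : 3 ≤ d) (u : List (Fin d)) :
    ((groupG d).comap (belowWordHom u)).relIndex (groupG d) ≠ 0 := by
  induction u with
  | nil => simp [belowWordHom]
  | cons x u ih =>
    have hx : ((groupG d).comap (belowHom x)).relIndex (groupG d) ≠ 0 :=
      (branching_finiteIndex hd hd3 x).index_ne_zero
    -- Pulling back along `belowWordHom u` compares the condition for `x :: u` with that for `u`.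
    have h := Subgroup.relIndex_comap_ne_zero (belowWordHom u) hx
    exact Subgroup.relIndex_ne_zero_trans h ih

theorem levelRist_relIndex {d : ℕ} (hd : Odd d) (hd3 : 3 ≤ d) (k : ℕ) :
    (levelRist (groupG d) k).relIndex (groupG d) ≠ 0 := by
  have hfin : Finite {u : List (Fin d) | u.length = k} := List.finite_length_eq _ k
  have h := Subgroup.relIndex_iInf_ne_zero
    (f := fun u : {u : List (Fin d) | u.length = k} => (groupG d).comap (belowWordHom u.1))
    (L := groupG d) fun u => comap_belowWordHom_relIndex hd hd3 u.1
  refine mt (Subgroup.relIndex_eq_zero_of_le_left ?_) (belowLevel_relIndex k h)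
  refine iSup₂_mono fun u hu => ?_
  rintro _ ⟨g, hg, rfl⟩
  exact ⟨Subgroup.mem_iInf.1 hg ⟨u, hu⟩, fun v => belowWordHom_apply_of_not_prefix u g⟩

theorem mainTheorem5 (d : ℕ) (hd : Odd d) (hd3 : 3 ≤ d) : IsBranchGroup (groupG d) :=
  ⟨levelTransitive_groupG hd hd3, fun k => ⟨levelRist_relIndex hd hd3 k⟩⟩
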